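/- Let $N\ge 1$ and $\Sigma_S=\{-1,1\}^S$. Let $(\beta_p)_{p\ge2}$ be nonnegative with $\beta:=\sum_{p\ge2}\sqrt{p^3\log p}\,\beta_p<\infty$, let $\eta\in\mathbb R^N$, and let $g_{i_1\dots i_p}$ ($p\ge 2$, $1\le i_1,\dots,i_p\le N$) be i.i.d. standard Gaussians for pairwise distinct indices and $0$ whenever two indices coincide. For disjoint $A,B\subset\{1,\dots,N\}$ and fixed $\sigma_A\in\Sigma_A$, let $$H^{[A,B]}(\sigma)=\sum_{p\ge2}\frac{\beta_p}{N^{(p-1)/2}}\sum_{i_1,\dots,i_p\in B^c}g_{i_1\dots i_p}\sigma_{i_1}\cdots\sigma_{i_p}+\sum_{i\in B^c}\eta_i\sigma_i ,$$ a function of the spins in $(A\cup B)^c$, and let $\langle\cdot\rangle_{[A,B]}$ and $\langle\cdot\,;\cdot\rangle_{[A,B]}$ be expectation and covariance in the Gibbs measure on $\Sigma_{(A\cup B)^c}$ with weights proportional to $e^{H^{[A,B]}}$. Put $(\partial_jf)(\sigma)=\frac12\big(f(\sigma)-f(\hat\sigma_j)\big)$, where $\hat\sigma_j$ is $\sigma$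 with the $j$-th spin flipped, $B_j^{[A,B]}=\sigma_j\partial_jH^{[A,B]}$, and $$D_{[A,B]}(f)=\sum_{j\notin A\cup B}\big\langle\cosh^{-2}(B_j^{[A,B]})(\partial_jf)^2\big\rangle_{[A,B]},\qquad a_{[A,B]}(\sigma_A)=\sup_{f\ne\mathrm{const}}\frac{\langle f;f\rangle_{[A,B]}}{D_{[A,B]}(f)},\qquad a_{N-k}=\max_{\substack{A\cap B=\emptyset\\|A\cup B|=k}}\ \max_{\sigma_A}\,a_{[A,B]}(\sigma_A).$$ Let $\Omega$ be the event that for all disjoint $A,B$, all $\sigma_A\in\Sigma_A$ and all $\sigma\in\Sigma_{(A\cup B)^c}$ the $\ell^2$ operator norm of the matrix $\big(\partial_iB_j^{[A,B]}(\sigma)\big)_{i,j\notin A\cup B}$ is at most $5\beta$, and let $C_\beta=(10^3\beta)^2e^{10^3\beta}$. Then there are universal constants $\beta_0>0$ and $C>0$ such that for all $N$, $\eta$, $(\beta_p)_{p\ge2}$ as above with $0<\beta\le\beta_0$, and all $\epsilon\in(0,10^{-2})$, $$\mathbb P\bigg(\Omega\cap\bigcup_{k=0}^{N-2}\big\{a_{N-k-1}C_\beta<\epsilon\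 \text{ and }\ a_{N-k}>5a_{N-k-1}\big\}\bigg)\le C\exp\bigg(\Big(\frac{C\epsilon}{C_\beta}+2\Big)\log N+N\log4-\frac{N\,C_\beta^2}{C\epsilon^2\beta^2}\bigg).$$ -/

import Mathlib

open MeasureTheory ProbabilityTheory

noncomputable section

namespace MixedPSpin

/-- Spin configurations in `{-1, 1}^ι`; the type `ℤˣ` has exactly the two elements `1` and `-1`. -/
abbrev Config (ι : Type*) := ι → ℤˣ

/-- The real value `±1` of a spin. -/
def spin (u : ℤˣ) : ℝ := ((u : ℤ) : ℝ)

/-- The configuration with the spin at site `i` flipped. -/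
def flipAt {ι : Type*} [DecidableEq ι] (i : ι) (σ : Config ι) : Config ι :=
  Function.update σ i (-σ i)

/-- The discrete partial derivative `(∂ᵢ f)(σ) = (f(σ) - f(σ̂ᵢ)) / 2`. -/
def partialD {ι : Type*} [DecidableEq ι] (i : ι) (f : Config ι → ℝ) (σ : Config ι) : ℝ :=
  (f σ - f (flipAt i σ)) / 2

/-- The expectation `⟨f⟩` in the Gibbs measure with weights `exp (H σ) / Z`. -/
def gibbsMean {ι : Type*} [Fintype ι] [DecidableEq ι] (H f : Config ι → ℝ) : ℝ :=
  (∑ σ, Real.exp (H σ) * f σ) / ∑ σ, Real.exp (H σ)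

/-- The covariance `⟨f ; h⟩` in the Gibbs measure of `H`. -/
def gibbsCov {ι : Type*} [Fintype ι] [DecidableEq ι] (H f h : Config ι → ℝ) : ℝ :=
  gibbsMean H (fun σ => f σ * h σ) - gibbsMean H f * gibbsMean H h

/-- The cavity field `B_j(σ) = σ_j (∂_j H)(σ)`. -/
def cavityField {ι : Type*} [DecidableEq ι] (H : Config ι → ℝ) (j : ι) (σ : Config ι) : ℝ :=
  spin (σ j) * partialD j H σ

/-- The Dirichlet form `D(f) = ∑ⱼ ⟨cosh⁻²(Bⱼ) (∂ⱼ f)²⟩`. -/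
def dirichletForm {ι : Type*} [Fintype ι] [DecidableEq ι] (H f : Config ι → ℝ) : ℝ :=
  ∑ j, gibbsMean H (fun σ => (Real.cosh (cavityField H j σ) ^ 2)⁻¹ * partialD j f σ ^ 2)

/-- The inverse spectral gap, the supremum of `⟨f ; f⟩ / D(f)` over the non-constant `f`.
For a nonempty finite `ι` this set of reals is nonempty and bounded above. -/
def inverseGap {ι : Type*} [Fintype ι] [DecidableEq ι] (H : Config ι → ℝ) : ℝ :=
  sSup {r : ℝ | ∃ f : Config ι → ℝ, (¬ ∃ c : ℝ, ∀ σ, f σ = c) ∧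
    r = gibbsCov H f f / dirichletForm H f}

/-- The sites `(A ∪ B)ᶜ`. -/
abbrev Free {N : ℕ} (A B : Finset (Fin N)) := {i : Fin N // i ∉ A ∪ B}

/-- The spins `(σ_A, τ)` of the conditioned subsystem as real numbers. The value at the removed
sites `B` is set to zero; it is never used in the Hamiltonian. -/
def joinSpins {N : ℕ} (A B : Finset (Fin N)) (σA : Config A) (τ : Config (Free A B))
    (i : Fin N) : ℝ :=
  if hA : i ∈ A then spin (σA ⟨i, hA⟩)
  else if hB : i ∈ B then 0
  else spin (τ ⟨i, by simp [hA, hB]⟩)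

/-- The Hamiltonian `H_N^{[A,B]}` of the spins in `(A ∪ B)ᶜ`, given `σ_A` and with the spins in `B`
removed, for the coefficients `βs p`, the field `η` and the couplings `g`. If `g` vanishes on
the tuples with coinciding indices, only the terms `p ≤ N` are nonzero. -/
def subHamiltonian {N : ℕ} (βs : ℕ → ℝ) (η : Fin N → ℝ) (g : (p : ℕ) → (Fin p → Fin N) → ℝ)
    (A B : Finset (Fin N)) (σA : Config A) (τ : Config (Free A B)) : ℝ :=
  (∑' p : {p : ℕ // 2 ≤ p}, βs p.1 / (N : ℝ) ^ (((p.1 : ℝ) - 1) / 2) *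
    (∑ i : Fin p.1 → Fin N with ∀ k, i k ∉ B,
      g p.1 i * ∏ k, joinSpins A B σA τ (i k))) +
  ∑ i : Fin N with i ∉ B, η i * joinSpins A B σA τ i

/-- The maximal inverse gap over the subsystems of `N - k` spins, i.e. over all disjoint `A`, `B`
with `|A ∪ B| = k` and all `σ_A`. -/
def maxInverseGap {N : ℕ} (βs : ℕ → ℝ) (η : Fin N → ℝ) (g : (p : ℕ) → (Fin p → Fin N) → ℝ)
    (k : ℕ) : ℝ :=
  sSup {a : ℝ | ∃ A B : Finset (Fin N), Disjoint A B ∧ (A ∪ B).card = k ∧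
    ∃ σA : Config A, a = inverseGap (subHamiltonian βs η g A B σA)}

/-- The temperature parameter `β = ∑_{p ≥ 2} √(p³ log p) β_p`. -/
def temperature (βs : ℕ → ℝ) : ℝ :=
  ∑' p : {p : ℕ // 2 ≤ p}, Real.sqrt ((p.1 : ℝ) ^ 3 * Real.log p.1) * βs p.1

/-- The constant `C_β = (10³ β)² exp(10³ β)`. -/
def Cconst (β : ℝ) : ℝ := (10 ^ 3 * β) ^ 2 * Real.exp (10 ^ 3 * β)

/-- The matrix `(∂ᵢ Bⱼ(σ))_{i,j}` of derivatives of the cavity fields. -/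
def cavityMatrix {ι : Type*} [DecidableEq ι] (H : Config ι → ℝ) (σ : Config ι) :
    Matrix ι ι ℝ :=
  Matrix.of fun i j => partialD i (cavityField H j) σ

/-- The event that for all subsystems, all `σ_A` and all `σ`, the `ℓ²` operator norm
of the matrix `(∂ᵢ Bⱼ^{[A,B]}(σ))_{i,j}` is at most `5β`. -/
def goodEvent {Ω : Type*} {N : ℕ} (βs : ℕ → ℝ) (η : Fin N → ℝ)
    (g : (p : ℕ) → (Fin p → Fin N) → Ω → ℝ) : Set Ω :=
  {ω | ∀ A B : Finset (Fin N), Disjoint A B → ∀ (σA : Config A) (τ : Config (Free A B)),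
    ‖Matrix.toEuclideanCLM (𝕜 := ℝ)
      (cavityMatrix (subHamiltonian βs η (fun p i => g p i ω) A B σA) τ)‖
      ≤ 5 * temperature βs}

/-- The couplings of an `N`-spin system: the `g_{i₁…i_p}` with pairwise distinct indices (and
`p ≥ 2`) are i.i.d. standard Gaussians, the ones with coinciding indices vanish. -/
structure IsGaussianCouplings {Ω : Type*} [MeasurableSpace Ω] (μ : Measure Ω) {N : ℕ}
    (g : (p : ℕ) → (Fin p → Fin N) → Ω → ℝ) : Prop where
  eq_zero : ∀ (p : ℕ) (i : Fin p → Fin N), ¬ Function.Injective i → ∀ ω, g p i ω = 0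
  law : ∀ (p : ℕ) (i : Fin p → Fin N), 2 ≤ p → Function.Injective i →
    HasLaw (g p i) (gaussianReal 0 1) μ
  indep : iIndepFun
    (fun t : {t : (p : ℕ) × (Fin p → Fin N) // 2 ≤ t.1 ∧ Function.Injective t.2} =>
      g t.1.1 t.1.2) μ

end MixedPSpin

end

open MixedPSpin

/-!
# Spectral gap of mixed `p`-spin models from a bound on the cavity matrix

If `‖(∂ᵢ Bⱼ(σ))‖ ≤ κ ≤ 1 / 100` for every `σ`, integrating by parts twice gives the Bakry–Émery
inequality `⟨(L f)²⟩ ≥ D(f) / 2` for the heat-bath generator `L`, hence the Poincaré inequality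
`⟨f ; f⟩ ≤ 2 D(f)`. A spin observable shows that the inverse gap is at least `1`. So on the
good event with `β ≤ 1 / 500` all inverse gaps of nonempty subsystems lie in `[1, 2]`, and none of
them exceeds five times another one: the event of the theorem has probability zero.
-/

namespace MixedPSpin

/-! ### Discrete calculus on the hypercube -/

section Calculus

variable {ι : Type*} [DecidableEq ι]

/-! Write D_i f = σ_i ∂_i f (`cavityField f i`), a function not depending on σ_i, and J_ij = D_i
B_j. Given the other spins, σ_i has mean tanh B_i and variance cosh⁻²(B_i); this is the integration
by parts `gibbsSum_centeredSpin_mul`. With g_i = (σ_i - tanh B_i) D_i f and Lf = ∑ g_i it gives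
⟨(Lf) h⟩ = D(f, h), where D(f, h) is the polarized Dirichlet form.

For ⟨(Lf)²⟩ = ∑ ⟨g_i g_j⟩, the diagonal is exactly D(f). Off the diagonal a second integration by
parts produces a positive multiple of (D_i D_j f)², which absorbs every other term containing D_i
D_j f. What is left is the bilinear form of J in the vector cosh⁻²(B_i) D_i f, controlled by the
operator norm, and errors of order J_ij², controlled by column norms (`pairTerm_ge`,
`sum_pairTerm_ge`). All errors are relative to cosh⁻²(B_i), so the estimate is uniform in the
external field.

Solving Lh = f for centred f turns ⟨(Lh)²⟩ ≥ D(h)/2 into the Poincaré inequality (`gibbsSum_sq_le`).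
With the lower bound 1 from a single spin, on the good event a jump by a factor 5 would force 5 < 2.
-/

theorem spin_sq (u : ℤˣ) : spin u * spin u = 1 := by
  rcases Int.units_eq_one_or u with h | h <;> simp [h, spin]

theorem spin_neg (u : ℤˣ) : spin (-u) = -spin u := by
  simp [spin]

theorem abs_spin (u : ℤˣ) : |spin u| = 1 := by
  rcases Int.units_eq_one_or u with h | h <;> simp [h, spin]

theorem flipAt_flipAt (i : ι) (σ : Config ι) : flipAt i (flipAt i σ) = σ := by
  simp [flipAt]

theorem flipAt_self (i : ι) (σ : Config ι) : flipAt i σ i = -σ i := by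
  simp [flipAt]

theorem flipAt_of_ne {i j : ι} (h : j ≠ i) (σ : Config ι) : flipAt i σ j = σ j := by
  simp [flipAt, h]

theorem flipAt_comm (i j : ι) (σ : Config ι) :
    flipAt i (flipAt j σ) = flipAt j (flipAt i σ) := by
  by_cases h : i = j
  · rw [h]
  · ext k
    by_cases hi : k = i <;> by_cases hj : k = j <;> simp_all [flipAt, Function.update_apply]

theorem spin_mul_cavityField (f : Config ι → ℝ) (j : ι) (σ : Config ι) :
    spin (σ j) * cavityField f j σ = partialD j f σ := by
  rw [cavityField, ← mul_assoc, spin_sq, one_mul]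

theorem cavityField_flipAt_self (f : Config ι → ℝ) (j : ι) (σ : Config ι) :
    cavityField f j (flipAt j σ) = cavityField f j σ := by
  simp only [cavityField, partialD, flipAt_flipAt, flipAt_self, spin_neg]
  ring

/-- Both sides are σ_i σ_j times the mixed second difference. Hence J is symmetric, although the
matrix of the ∂_i B_j, which carries an extra sign σ_i, need not be. -/
theorem cavityField_comm {i j : ι} (h : i ≠ j) (f : Config ι → ℝ) (σ : Config ι) :
    cavityField (cavityField f j) i σ = cavityField (cavityField f i) j σ := by
  simp only [cavityField, partialD, flipAt_of_ne h, flipAt_of_ne h.symm, flipAt_comm i j]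
  ring

theorem apply_flipAt (f : Config ι → ℝ) (i : ι) (σ : Config ι) :
    f (flipAt i σ) = f σ - 2 * (spin (σ i) * cavityField f i σ) := by
  rw [spin_mul_cavityField, partialD]
  ring

/-- The discrete Leibniz rule has a second-order correction; it is the source of the terms with
explicit spin factors in `pairTerm`. -/
theorem cavityField_mul (f h : Config ι → ℝ) (i : ι) (σ : Config ι) :
    cavityField (fun τ => f τ * h τ) i σ =
      cavityField f i σ * h σ + f σ * cavityField h i σ
        - 2 * (spin (σ i) * cavityField f i σ * cavityField h i σ) := by
  have hs := spin_sq (σ i)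
  simp only [cavityField, partialD]
  linear_combination
    (spin (σ i) * (f σ - f (flipAt i σ)) * (h σ - h (flipAt i σ)) / 2) * hs

theorem cavityField_const (c : ℝ) (j : ι) (σ : Config ι) :
    cavityField (fun _ => c) j σ = 0 := by
  simp [cavityField, partialD]

theorem cavityField_sub_const (f : Config ι → ℝ) (c : ℝ) (j : ι) (σ : Config ι) :
    cavityField (fun τ => f τ - c) j σ = cavityField f j σ := by
  simp [cavityField, partialD]

theorem cavityField_spin (i j : ι) (σ : Config ι) :
    cavityField (fun τ => spin (τ j)) i σ = if i = j then 1 else 0 := by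
  by_cases h : i = j
  · subst h
    simp only [cavityField, partialD, flipAt_self, spin_neg, if_true]
    linear_combination spin_sq (σ i)
  · rw [if_neg h, cavityField, partialD, flipAt_of_ne (Ne.symm h)]
    simp

theorem cavityMatrix_apply (H : Config ι → ℝ) (σ : Config ι) (i j : ι) :
    cavityMatrix H σ i j = spin (σ i) * cavityField (cavityField H j) i σ := by
  rw [spin_mul_cavityField]
  rfl

/-- Any two configurations are joined by changing one spin at a time. -/
theorem eq_of_partialD_eq_zero [Fintype ι] {f : Config ι → ℝ}
    (h : ∀ j σ, cavityField f j σ = 0) (σ τ : Config ι) : f σ = f τ := by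
  have key : ∀ s : Finset ι, f (s.piecewise σ τ) = f τ := by
    intro s
    induction s using Finset.induction_on with
    | empty => simp
    | insert a s _ ih =>
      rw [← ih, Finset.piecewise_insert]
      by_cases hc : σ a = s.piecewise σ τ a
      · rw [hc, Function.update_eq_self]
      · have hn : σ a = -(s.piecewise σ τ a) := by
          rcases Int.units_eq_one_or (σ a) with h1 | h1 <;>
          rcases Int.units_eq_one_or (s.piecewise σ τ a) with h2 | h2 <;> simp_all
        rw [hn]
        have := apply_flipAt f a (s.piecewise σ τ)
        rw [h] at this
        simpa [flipAt] using this
  simpa using key Finset.univ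

/-- The conditional variance `cosh⁻²(B_j)` of the spin at `j`. -/
noncomputable def spinVar (H : Config ι → ℝ) (j : ι) (σ : Config ι) : ℝ :=
  (Real.cosh (cavityField H j σ) ^ 2)⁻¹

/-- The spin at `j` minus its conditional mean `tanh B_j`. -/
noncomputable def centeredSpin (H : Config ι → ℝ) (j : ι) (σ : Config ι) : ℝ :=
  spin (σ j) - Real.tanh (cavityField H j σ)

theorem spinVar_pos (H : Config ι → ℝ) (j : ι) (σ : Config ι) : 0 < spinVar H j σ := by
  have := Real.cosh_pos (cavityField H j σ)
  unfold spinVar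
  positivity

theorem spinVar_le_one (H : Config ι → ℝ) (j : ι) (σ : Config ι) : spinVar H j σ ≤ 1 :=
  inv_le_one_of_one_le₀ (one_le_pow₀ (Real.one_le_cosh _))

end Calculus

/-! ### Integration by parts -/

section IBP

variable {ι : Type*} [Fintype ι] [DecidableEq ι]

/-- The unnormalized Gibbs expectation. -/
noncomputable def gibbsSum (H f : Config ι → ℝ) : ℝ := ∑ σ, Real.exp (H σ) * f σ

theorem sum_flipAt (i : ι) (F : Config ι → ℝ) : ∑ σ, F (flipAt i σ) = ∑ σ, F σ :=
  Equiv.sum_comp (Function.Involutive.toPerm (flipAt i) (flipAt_flipAt i)) F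

theorem gibbsSum_add (H f h : Config ι → ℝ) :
    gibbsSum H (fun σ => f σ + h σ) = gibbsSum H f + gibbsSum H h := by
  simp [gibbsSum, mul_add, Finset.sum_add_distrib]

theorem gibbsSum_const_mul (H f : Config ι → ℝ) (c : ℝ) :
    gibbsSum H (fun σ => c * f σ) = c * gibbsSum H f := by
  simp only [gibbsSum, Finset.mul_sum]
  exact Finset.sum_congr rfl fun _ _ => by ring

theorem gibbsSum_sum {κ : Type*} (s : Finset κ) (H : Config ι → ℝ) (F : κ → Config ι → ℝ) :
    gibbsSum H (fun σ => ∑ k ∈ s, F k σ) = ∑ k ∈ s, gibbsSum H (F k) := by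
  simp only [gibbsSum, Finset.mul_sum]
  exact Finset.sum_comm

theorem gibbsSum_mono {H f h : Config ι → ℝ} (hfh : ∀ σ, f σ ≤ h σ) :
    gibbsSum H f ≤ gibbsSum H h :=
  Finset.sum_le_sum fun σ _ => mul_le_mul_of_nonneg_left (hfh σ) (Real.exp_pos _).le

theorem gibbsSum_nonneg {H f : Config ι → ℝ} (hf : ∀ σ, 0 ≤ f σ) : 0 ≤ gibbsSum H f :=
  Finset.sum_nonneg fun σ _ => mul_nonneg (Real.exp_pos _).le (hf σ)

theorem gibbsSum_eq_zero {H f : Config ι → ℝ} (hf : ∀ σ, 0 ≤ f σ) (h : gibbsSum H f = 0)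
    (σ : Config ι) : f σ = 0 := by
  have := (Finset.sum_eq_zero_iff_of_nonneg
    (fun σ _ => mul_nonneg (Real.exp_pos (H σ)).le (hf σ))).1 h σ (Finset.mem_univ σ)
  exact (mul_eq_zero.1 this).resolve_left (Real.exp_pos _).ne'

theorem gibbsSum_one_pos (H : Config ι → ℝ) : 0 < gibbsSum H fun _ => 1 :=
  Finset.sum_pos (fun σ _ => by positivity) Finset.univ_nonempty

theorem exp_mul_sub_tanh (B : ℝ) : Real.exp B * (1 - Real.tanh B) = (Real.cosh B)⁻¹ := by
  have h := Real.cosh_pos B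
  rw [Real.tanh_eq_sinh_div_cosh, one_sub_div h.ne', Real.cosh_sub_sinh, ← mul_div_assoc,
    ← Real.exp_add]
  simp

/-- Integration by parts in the spin at `i`. -/
theorem gibbsSum_centeredSpin_mul (H : Config ι → ℝ) (i : ι) {φ : Config ι → ℝ}
    (hφ : ∀ σ, φ (flipAt i σ) = φ σ) (h : Config ι → ℝ) :
    gibbsSum H (fun σ => centeredSpin H i σ * φ σ * h σ) =
      gibbsSum H (fun σ => spinVar H i σ * φ σ * cavityField h i σ) := by
  -- Averaging each configuration with its flip reduces the claim to an identity on a two-point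
  -- fibre.
  have sym : ∀ F : Config ι → ℝ, ∑ σ, F σ = ∑ σ, (F σ + F (flipAt i σ)) / 2 := by
    intro F
    rw [← Finset.sum_div, Finset.sum_add_distrib, sum_flipAt]
    ring
  unfold gibbsSum
  rw [sym, sym (fun σ => Real.exp (H σ) * (spinVar H i σ * φ σ * cavityField h i σ))]
  refine Finset.sum_congr rfl fun σ _ => ?_
  congr 1
  simp only [centeredSpin, spinVar, hφ, cavityField_flipAt_self, flipAt_self, spin_neg]
  rw [apply_flipAt H]
  set B := cavityField H i σ
  have hD : cavityField h i σ = spin (σ i) * ((h σ - h (flipAt i σ)) / 2) := rfl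
  rw [hD]
  have hc := (Real.cosh_pos B).ne'
  have e1 := exp_mul_sub_tanh B
  have e2 := exp_mul_sub_tanh (-B)
  rw [Real.tanh_neg, Real.cosh_neg] at e2
  have e3 : Real.cosh B = (Real.exp B + Real.exp (-B)) / 2 := Real.cosh_eq B
  have e4 : (Real.cosh B ^ 2)⁻¹ * ((Real.exp B + Real.exp (-B)) / 2) = (Real.cosh B)⁻¹ := by
    rw [← e3]; field_simp
  have hs : spin (σ i) = 1 ∨ spin (σ i) = -1 := by
    rcases Int.units_eq_one_or (σ i) with h | h <;> simp [h, spin]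
  have e5 : Real.exp B * Real.exp (-B) = 1 := by rw [← Real.exp_add]; simp
  rcases hs with hs | hs
  -- The common factor is the exponential of the mean energy of the two configurations; the
  -- remaining weights are exp(±B).
  · have e : Real.exp (H σ - 2 * (spin (σ i) * B)) =
        Real.exp (H σ - B) * Real.exp (-B) := by rw [← Real.exp_add, hs]; ring_nf
    have e' : Real.exp (H σ) = Real.exp (H σ - B) * Real.exp B := by
      rw [← Real.exp_add]; ring_nf
    rw [e, e', hs]
    linear_combination (Real.exp (H σ - B) * φ σ) *
      (h σ * e1 - h (flipAt i σ) * e2 - (h σ - h (flipAt i σ)) * e4)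
  · have e : Real.exp (H σ - 2 * (spin (σ i) * B)) =
        Real.exp (H σ + B) * Real.exp B := by rw [← Real.exp_add, hs]; ring_nf
    have e' : Real.exp (H σ) = Real.exp (H σ + B) * Real.exp (-B) := by
      rw [← Real.exp_add]; ring_nf
    rw [e, e', hs]
    linear_combination (Real.exp (H σ + B) * φ σ) *
      (-(h σ) * e2 + h (flipAt i σ) * e1 + (h σ - h (flipAt i σ)) * e4)

end IBP

/-! ### Local variation of `tanh` and `cosh⁻²` -/

theorem abs_sinh_sub_self_le {x : ℝ} (hx : |x| ≤ 1) : |Real.sinh x - x| ≤ x ^ 2 := by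
  have h1 := abs_le.1 (Real.abs_exp_sub_one_sub_id_le hx)
  have h2 := abs_le.1 (Real.abs_exp_sub_one_sub_id_le (x := -x) (by rwa [abs_neg]))
  rw [Real.sinh_eq, abs_le]
  constructor <;> nlinarith

theorem cosh_sub_one_le {x : ℝ} (hx : |x| ≤ 1) : Real.cosh x - 1 ≤ x ^ 2 := by
  have h1 := abs_le.1 (Real.abs_exp_sub_one_sub_id_le hx)
  have h2 := abs_le.1 (Real.abs_exp_sub_one_sub_id_le (x := -x) (by rwa [abs_neg]))
  rw [Real.cosh_eq]
  nlinarith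

theorem cosh_sub_eq (B z : ℝ) :
    Real.cosh (B - z) = Real.cosh B * (Real.cosh z - Real.tanh B * Real.sinh z) := by
  have h := (Real.cosh_pos B).ne'
  rw [Real.cosh_sub, Real.tanh_eq_sinh_div_cosh]
  field_simp

/-- By `cosh_sub_eq` the quantity compared with 1 is cosh(B - 2y) / cosh B; since |tanh B| ≤ 1, the
bound is uniform in B. -/
theorem abs_cosh_ratio_sub_one_le (B : ℝ) {y : ℝ} (hy : |y| ≤ 1 / 20) :
    |Real.cosh (2 * y) - Real.tanh B * Real.sinh (2 * y) - 1| ≤ 3 * |y| := by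
  have h2y : |2 * y| ≤ 1 := by rw [abs_mul]; norm_num; linarith
  have hs := abs_sinh_sub_self_le h2y
  have hc := cosh_sub_one_le h2y
  have hc' := Real.one_le_cosh (2 * y)
  have ht : |Real.tanh B| ≤ 1 := (Real.abs_tanh_lt_one B).le
  have hy2 : (2 * y) ^ 2 ≤ |y| / 5 := by
    rw [mul_pow, ← sq_abs y]; nlinarith [abs_nonneg y]
  have hsa : |Real.sinh (2 * y)| ≤ 2 * |y| + |y| / 5 := by
    calc |Real.sinh (2 * y)| = |(Real.sinh (2 * y) - 2 * y) + 2 * y| := by ring_nf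
      _ ≤ _ := abs_add_le _ _
      _ ≤ _ := by rw [abs_mul 2 y, abs_two]; linarith
  have hts : |Real.tanh B * Real.sinh (2 * y)| ≤ 2 * |y| + |y| / 5 := by
    rw [abs_mul]
    nlinarith [abs_nonneg (Real.sinh (2 * y)), abs_nonneg (Real.tanh B)]
  have := abs_le.1 hts
  rw [abs_le]
  constructor <;> linarith [abs_nonneg y]

theorem tanh_sub_tanh_sub (B z : ℝ) :
    Real.tanh B - Real.tanh (B - z) =
      (Real.cosh B ^ 2)⁻¹ *
        (Real.sinh z / (Real.cosh z - Real.tanh B * Real.sinh z)) := by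
  have h := (Real.cosh_pos B).ne'
  have h' := (Real.cosh_pos (B - z)).ne'
  have hr : Real.cosh z - Real.tanh B * Real.sinh z = Real.cosh (B - z) / Real.cosh B := by
    rw [cosh_sub_eq]; field_simp
  rw [hr]
  have e : Real.sinh z = Real.sinh B * Real.cosh (B - z) - Real.cosh B * Real.sinh (B - z) := by
    rw [← Real.sinh_sub]; ring_nf
  rw [Real.tanh_eq_sinh_div_cosh, Real.tanh_eq_sinh_div_cosh, e]
  field_simp

/-- A first-order expansion whose error keeps the factor cosh⁻²(B): the cavity fields are unbounded,
and an absolute error could not be absorbed by the Dirichlet form. -/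
theorem abs_tanh_increment_le (B : ℝ) {y : ℝ} (hy : |y| ≤ 1 / 20) :
    |(Real.tanh B - Real.tanh (B - 2 * y)) / 2 - (Real.cosh B ^ 2)⁻¹ * y| ≤
      10 * y ^ 2 * (Real.cosh B ^ 2)⁻¹ := by
  have hpos : 0 < (Real.cosh B ^ 2)⁻¹ := by have := Real.cosh_pos B; positivity
  have h2y : |2 * y| ≤ 1 := by rw [abs_mul]; norm_num; linarith
  have hs := abs_sinh_sub_self_le h2y
  have hr := abs_cosh_ratio_sub_one_le B hy
  rw [tanh_sub_tanh_sub]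
  set r := Real.cosh (2 * y) - Real.tanh B * Real.sinh (2 * y)
  set s := Real.sinh (2 * y)
  have hr1 := abs_le.1 hr
  have hrpos : 17 / 20 ≤ r := by linarith [hr1.1]
  have e : (Real.cosh B ^ 2)⁻¹ * (s / r) / 2 - (Real.cosh B ^ 2)⁻¹ * y =
      (Real.cosh B ^ 2)⁻¹ * (((s - 2 * y) - 2 * y * (r - 1)) / (2 * r)) := by
    have : r ≠ 0 := by linarith
    field_simp
    ring
  rw [e, abs_mul, abs_of_pos hpos, mul_comm (10 * y ^ 2)]
  refine mul_le_mul_of_nonneg_left ?_ hpos.le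
  rw [abs_div, abs_of_pos (show 0 < 2 * r by linarith), div_le_iff₀ (by linarith)]
  have h3 : |2 * y * (r - 1)| ≤ 6 * y ^ 2 := by
    rw [abs_mul, abs_mul, abs_two, ← sq_abs y]
    nlinarith [abs_nonneg y]
  calc |(s - 2 * y) - 2 * y * (r - 1)| ≤ |s - 2 * y| + |2 * y * (r - 1)| := abs_sub _ _
    _ ≤ (2 * y) ^ 2 + 6 * y ^ 2 := add_le_add hs h3
    _ ≤ 10 * y ^ 2 * (2 * r) := by nlinarith [sq_nonneg y]

theorem abs_sech_sq_increment_le (B : ℝ) {y : ℝ} (hy : |y| ≤ 1 / 20) :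
    |((Real.cosh B ^ 2)⁻¹ - (Real.cosh (B - 2 * y) ^ 2)⁻¹) / 2| ≤
      6 * |y| * (Real.cosh B ^ 2)⁻¹ := by
  have hpos : 0 < (Real.cosh B ^ 2)⁻¹ := by have := Real.cosh_pos B; positivity
  have hr := abs_cosh_ratio_sub_one_le B hy
  rw [cosh_sub_eq]
  set r := Real.cosh (2 * y) - Real.tanh B * Real.sinh (2 * y)
  have hr1 := abs_le.1 hr
  have hrpos : 17 / 20 ≤ r := by linarith [hr1.1]
  have hc := (Real.cosh_pos B).ne'
  have e : ((Real.cosh B ^ 2)⁻¹ - ((Real.cosh B * r) ^ 2)⁻¹) / 2 =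
      (Real.cosh B ^ 2)⁻¹ * (((r - 1) * (r + 1)) / (2 * r ^ 2)) := by
    have : r ≠ 0 := by linarith
    field_simp
    ring
  rw [e, abs_mul, abs_of_pos hpos, mul_comm (6 * |y|)]
  refine mul_le_mul_of_nonneg_left ?_ hpos.le
  have hr2 : (0 : ℝ) < 2 * r ^ 2 := by positivity
  rw [abs_div, abs_of_pos hr2, div_le_iff₀ hr2, abs_mul,
    abs_of_pos (show 0 < r + 1 by linarith)]
  calc |r - 1| * (r + 1) ≤ 3 * |y| * (r + 1) :=
        mul_le_mul_of_nonneg_right hr (by linarith)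
    _ = |y| * (3 * (r + 1)) := by ring
    _ ≤ |y| * (6 * (2 * r ^ 2)) :=
        mul_le_mul_of_nonneg_left (by nlinarith) (abs_nonneg y)
    _ = _ := by ring

/-! ### The Bakry–Émery estimate -/

section Pair

variable {ι : Type*} [DecidableEq ι]

theorem abs_cavityField_tanh_sub_le (H : Config ι → ℝ) (i j : ι) (σ : Config ι)
    (hJ : |cavityField (cavityField H j) i σ| ≤ 1 / 20) :
    |cavityField (fun τ => Real.tanh (cavityField H j τ)) i σ
        - spinVar H j σ * cavityField (cavityField H j) i σ| ≤
      10 * cavityField (cavityField H j) i σ ^ 2 * spinVar H j σ := by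
  set J := cavityField (cavityField H j) i σ
  have hx := spin_sq (σ i)
  have hy : |spin (σ i) * J| ≤ 1 / 20 := by rwa [abs_mul, abs_spin, one_mul]
  have h := abs_tanh_increment_le (cavityField H j σ) hy
  have e : cavityField (fun τ => Real.tanh (cavityField H j τ)) i σ - spinVar H j σ * J =
      spin (σ i) * ((Real.tanh (cavityField H j σ) -
        Real.tanh (cavityField H j σ - 2 * (spin (σ i) * J))) / 2 -
        (Real.cosh (cavityField H j σ) ^ 2)⁻¹ * (spin (σ i) * J)) := by
    rw [cavityField, partialD, apply_flipAt (cavityField H j), spinVar]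
    linear_combination ((Real.cosh (cavityField H j σ) ^ 2)⁻¹ * J) * hx
  rw [e, abs_mul, abs_spin, one_mul]
  rwa [mul_pow, pow_two (spin (σ i)), hx, one_mul] at h

theorem abs_cavityField_spinVar_le (H : Config ι → ℝ) (i j : ι) (σ : Config ι)
    (hJ : |cavityField (cavityField H j) i σ| ≤ 1 / 20) :
    |cavityField (spinVar H j) i σ| ≤
      6 * |cavityField (cavityField H j) i σ| * spinVar H j σ := by
  set J := cavityField (cavityField H j) i σ
  have hy : |spin (σ i) * J| ≤ 1 / 20 := by rwa [abs_mul, abs_spin, one_mul]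
  have h := abs_sech_sq_increment_le (cavityField H j σ) hy
  rw [cavityField, partialD, abs_mul, abs_spin, one_mul, spinVar, spinVar,
    apply_flipAt (cavityField H j)]
  rwa [abs_mul (spin _), abs_spin, one_mul] at h

theorem cavityField_centeredSpin_self (H : Config ι → ℝ) (i : ι) (σ : Config ι) :
    cavityField (centeredSpin H i) i σ = 1 := by
  simp only [cavityField, partialD, centeredSpin, flipAt_self, spin_neg]
  have := cavityField_flipAt_self H i σ
  simp only [cavityField, partialD, flipAt_self, spin_neg] at this
  rw [this]
  linear_combination spin_sq (σ i)

theorem cavityField_centeredSpin_of_ne (H : Config ι → ℝ) {i j : ι} (h : i ≠ j) (σ : Config ι) :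
    cavityField (centeredSpin H j) i σ =
      -cavityField (fun τ => Real.tanh (cavityField H j τ)) i σ := by
  rw [cavityField, cavityField, partialD, partialD, centeredSpin, centeredSpin,
    flipAt_of_ne h.symm]
  ring

theorem cavityField_self_self (f : Config ι → ℝ) (i : ι) (σ : Config ι) :
    cavityField (cavityField f i) i σ = 0 := by
  rw [cavityField, partialD, cavityField_flipAt_self]
  simp

/-- The component at `j` of the generator of the heat-bath dynamics. -/
noncomputable def genAt (H : Config ι → ℝ) (f : Config ι → ℝ) (j : ι) (σ : Config ι) : ℝ :=
  centeredSpin H j σ * cavityField f j σ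

/-- The off-diagonal integrand divided by cosh⁻²(B_i) cosh⁻²(B_j), with w = D_i D_j f. The
coefficient of w² stays at least 1 - 12/100, and half of w² absorbs the terms linear in w by
completing the square. The cost is 81/2 + 5 ≤ 50 times J². -/
theorem pair_lower_bound {J ρ θ x y w a b : ℝ} (hJ : |J| ≤ 1 / 100) (hρ : |ρ| ≤ 6 * |J|)
    (hθ : |θ| ≤ 10 * J ^ 2) (hx : |x| = 1) (hy : |y| = 1) :
    -J * (a * b) - 50 * J ^ 2 * (a ^ 2 + b ^ 2) ≤
      w ^ 2 - 2 * (y * ρ * w ^ 2) + ρ * w * a + 2 * (x * (J + θ) * a * w)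
        - (J + θ) * (a * b) := by
  have hJ0 := abs_nonneg J
  have hJ2 : 10 * J ^ 2 ≤ |J| / 10 := by rw [← sq_abs J]; nlinarith
  have h1 : y * ρ ≤ 6 * |J| := by
    calc y * ρ ≤ |y * ρ| := le_abs_self _
      _ = |ρ| := by rw [abs_mul, hy, one_mul]
      _ ≤ _ := hρ
  have hm : |ρ + 2 * (x * (J + θ))| ≤ 9 * |J| := by
    calc |ρ + 2 * (x * (J + θ))| ≤ |ρ| + |2 * (x * (J + θ))| := abs_add_le _ _
      _ = |ρ| + 2 * |J + θ| := by rw [abs_mul, abs_mul, hx, abs_two, one_mul]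
      _ ≤ |ρ| + 2 * (|J| + |θ|) := by gcongr; exact abs_add_le _ _
      _ ≤ _ := by linarith
  set m := ρ + 2 * (x * (J + θ)) with hmdef
  have hm2 : m ^ 2 ≤ 81 * J ^ 2 := by
    rw [← sq_abs m, ← sq_abs J]
    nlinarith [abs_nonneg m]
  have h2 : -(w ^ 2 / 2) - 81 / 2 * J ^ 2 * a ^ 2 ≤ m * a * w := by
    nlinarith [sq_nonneg (w + m * a), mul_le_mul_of_nonneg_right hm2 (sq_nonneg a)]
  have h3 : θ * (a * b) ≤ 10 * J ^ 2 * ((a ^ 2 + b ^ 2) / 2) := by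
    calc θ * (a * b) ≤ |θ| * |a * b| := by rw [← abs_mul]; exact le_abs_self _
      _ ≤ 10 * J ^ 2 * ((a ^ 2 + b ^ 2) / 2) := by
        refine mul_le_mul hθ ?_ (abs_nonneg _) (by positivity)
        rw [abs_le]
        constructor <;> nlinarith [sq_nonneg (a + b), sq_nonneg (a - b)]
  have h4 : y * ρ * w ^ 2 ≤ 6 / 100 * w ^ 2 :=
    mul_le_mul_of_nonneg_right (by linarith) (sq_nonneg w)
  have h5 : ρ * w * a + 2 * (x * (J + θ) * a * w) = m * a * w := by rw [hmdef]; ring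
  have h6 : 0 ≤ J ^ 2 * b ^ 2 := by positivity
  have h7 : 0 ≤ J ^ 2 * a ^ 2 := by positivity
  nlinarith [sq_nonneg w]

/-- The integrand of `⟨gᵢ gⱼ⟩`, for the components `gᵢ` of the generator, after integration by
parts in both spins. -/
noncomputable def pairTerm (H f : Config ι → ℝ) (i j : ι) (σ : Config ι) : ℝ :=
  if i = j then spinVar H i σ * cavityField f i σ ^ 2 else
    spinVar H i σ * spinVar H j σ * cavityField (cavityField f j) i σ ^ 2
    - 2 * (spin (σ j) * cavityField (spinVar H i) j σ * spinVar H j σ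
        * cavityField (cavityField f j) i σ ^ 2)
    + cavityField (spinVar H i) j σ * spinVar H j σ * cavityField (cavityField f j) i σ
        * cavityField f i σ
    + 2 * (spin (σ i) * cavityField (fun τ => Real.tanh (cavityField H j τ)) i σ
        * spinVar H i σ * cavityField f i σ * cavityField (cavityField f j) i σ)
    - cavityField (fun τ => Real.tanh (cavityField H j τ)) i σ * spinVar H i σ
        * (cavityField f i σ * cavityField f j σ)

theorem pairTerm_ge (H f : Config ι → ℝ) (i j : ι) (σ : Config ι)
    (hJ : |cavityField (cavityField H j) i σ| ≤ 1 / 100) :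
    (if i = j then spinVar H i σ * cavityField f i σ ^ 2 else 0)
      - cavityField (cavityField H j) i σ *
          ((spinVar H i σ * cavityField f i σ) * (spinVar H j σ * cavityField f j σ))
      - 50 * cavityField (cavityField H j) i σ ^ 2 *
          (spinVar H i σ * cavityField f i σ ^ 2 + spinVar H j σ * cavityField f j σ ^ 2) ≤
      pairTerm H f i j σ := by
  by_cases hij : i = j
  · subst hij
    simp [pairTerm, cavityField_self_self]
  · have hJ' : |cavityField (cavityField H i) j σ| ≤ 1 / 20 := by
      rw [← cavityField_comm hij]; linarith
    have hρ := abs_cavityField_spinVar_le H j i σ hJ'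
    have hθ := abs_cavityField_tanh_sub_le H i j σ (by linarith)
    rw [← cavityField_comm hij] at hρ
    rw [if_neg hij, pairTerm, if_neg hij]
    have hi := spinVar_pos H i σ
    have hj := spinVar_pos H j σ
    have hi1 := spinVar_le_one H i σ
    have hj1 := spinVar_le_one H j σ
    set J := cavityField (cavityField H j) i σ
    set a := cavityField f i σ
    set b := cavityField f j σ
    set w := cavityField (cavityField f j) i σ
    set p := spinVar H i σ
    set q := spinVar H j σ
    set ρ := cavityField (spinVar H i) j σ
    set θ := cavityField (fun τ => Real.tanh (cavityField H j τ)) i σ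
    -- Dividing by the conditional variances turns the increments into the relative errors of
    -- `pair_lower_bound`.
    have hρ' : |ρ / p| ≤ 6 * |J| := by
      rwa [abs_div, abs_of_pos hi, div_le_iff₀ hi]
    have hθ' : |(θ - q * J) / q| ≤ 10 * J ^ 2 := by
      rwa [abs_div, abs_of_pos hj, div_le_iff₀ hj]
    have key := mul_le_mul_of_nonneg_left
      (pair_lower_bound (w := w) (a := a) (b := b) hJ hρ' hθ' (abs_spin (σ i)) (abs_spin (σ j)))
      (mul_pos hi hj).le
    have e : p * q * (w ^ 2 - 2 * (spin (σ j) * (ρ / p) * w ^ 2) + ρ / p * w * a +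
        2 * (spin (σ i) * (J + (θ - q * J) / q) * a * w) - (J + (θ - q * J) / q) * (a * b)) =
        p * q * w ^ 2 - 2 * (spin (σ j) * ρ * q * w ^ 2) + ρ * q * w * a
        + 2 * (spin (σ i) * θ * p * a * w) - θ * p * (a * b) := by
      field_simp
      ring
    rw [e] at key
    have h1 : p * q * a ^ 2 ≤ p * a ^ 2 := by nlinarith [mul_nonneg hi.le (sq_nonneg a)]
    have h2 : p * q * b ^ 2 ≤ q * b ^ 2 := by nlinarith [mul_nonneg hj.le (sq_nonneg b)]
    have h3 := mul_le_mul_of_nonneg_left (add_le_add h1 h2) (show 0 ≤ 50 * J ^ 2 by positivity)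
    linarith

end Pair

/-! ### Consequences of the operator norm bound -/

section Matrix

variable {ι : Type*} [Fintype ι] [DecidableEq ι]

/-- Cauchy–Schwarz. The two vectors may differ, so that the signs σ_i separating the cavity matrix
from J can be moved into u. -/
theorem sum_mul_le_of_opNorm_le {M : Matrix ι ι ℝ} {κ : ℝ}
    (hM : ‖Matrix.toEuclideanCLM (𝕜 := ℝ) M‖ ≤ κ) (u v : ι → ℝ)
    (huv : ∑ i, u i ^ 2 = ∑ i, v i ^ 2) :
    ∑ i, ∑ j, u i * (M i j * v j) ≤ κ * ∑ i, v i ^ 2 := by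
  have e : ∑ i, ∑ j, u i * (M i j * v j) =
      inner ℝ (WithLp.toLp 2 u) (Matrix.toEuclideanCLM (𝕜 := ℝ) M (WithLp.toLp 2 v)) := by
    rw [Matrix.toEuclideanCLM_toLp, EuclideanSpace.inner_toLp_toLp]
    simp [Matrix.mulVec, dotProduct, Finset.mul_sum, mul_comm]
  have hn : ‖(WithLp.toLp 2 u : EuclideanSpace ℝ ι)‖ = ‖(WithLp.toLp 2 v : EuclideanSpace ℝ ι)‖ := by
    simp [EuclideanSpace.norm_eq, huv]
  have hv : ‖(WithLp.toLp 2 v : EuclideanSpace ℝ ι)‖ ^ 2 = ∑ i, v i ^ 2 := by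
    simp [EuclideanSpace.norm_sq_eq]
  rw [e, ← hv]
  refine (real_inner_le_norm _ _).trans ?_
  rw [hn]
  have h := (Matrix.toEuclideanCLM (𝕜 := ℝ) M).le_of_opNorm_le hM (WithLp.toLp 2 v)
  nlinarith [norm_nonneg (WithLp.toLp 2 v : EuclideanSpace ℝ ι)]

theorem sum_sq_col_le_of_opNorm_le {M : Matrix ι ι ℝ} {κ : ℝ}
    (hM : ‖Matrix.toEuclideanCLM (𝕜 := ℝ) M‖ ≤ κ) (j : ι) : ∑ i, M i j ^ 2 ≤ κ ^ 2 := by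
  have h := (Matrix.toEuclideanCLM (𝕜 := ℝ) M).le_of_opNorm_le hM
    (WithLp.toLp 2 (Pi.single j 1))
  have h1 : ‖(WithLp.toLp 2 (Pi.single j 1) : EuclideanSpace ℝ ι)‖ = 1 := by
    simp
  rw [h1, mul_one, Matrix.toEuclideanCLM_toLp] at h
  have h2 := pow_le_pow_left₀ (norm_nonneg _) h 2
  rw [EuclideanSpace.norm_sq_eq] at h2
  simpa using h2

end Matrix

/-! ### The heat-bath generator and the Poincaré inequality -/

section Gap

variable {ι : Type*} [Fintype ι] [DecidableEq ι]

theorem gibbsSum_genAt_mul (H f h : Config ι → ℝ) (i : ι) :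
    gibbsSum H (fun σ => genAt H f i σ * h σ) =
      gibbsSum H (fun σ => spinVar H i σ * cavityField f i σ * cavityField h i σ) :=
  gibbsSum_centeredSpin_mul H i (cavityField_flipAt_self f i) h

theorem gibbsSum_genAt_mul_genAt (H f : Config ι → ℝ) (i j : ι) :
    gibbsSum H (fun σ => genAt H f i σ * genAt H f j σ) = gibbsSum H (pairTerm H f i j) := by
  rw [gibbsSum_genAt_mul]
  by_cases hij : i = j
  · subst hij
    congr 1
    funext σ
    rw [show genAt H f i = fun τ => centeredSpin H i τ * cavityField f i τ from rfl,
      cavityField_mul, cavityField_centeredSpin_self, cavityField_self_self, pairTerm, if_pos rfl]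
    ring
  -- The mixed difference does not depend on σ_j, so it may play the role of φ in the integration by
  -- parts at j.
  · have hw : ∀ σ, cavityField (cavityField f j) i (flipAt j σ) =
        cavityField (cavityField f j) i σ := fun σ => by
      rw [cavityField_comm hij, cavityField_flipAt_self, cavityField_comm hij]
    have h := gibbsSum_centeredSpin_mul H j hw (fun τ => spinVar H i τ * cavityField f i τ)
    have e1 : (fun σ => spinVar H i σ * cavityField f i σ * cavityField (genAt H f j) i σ) =
        fun σ => centeredSpin H j σ * cavityField (cavityField f j) i σ *
            (spinVar H i σ * cavityField f i σ) +
          (2 * (spin (σ i) * cavityField (fun τ => Real.tanh (cavityField H j τ)) i σ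
            * spinVar H i σ * cavityField f i σ * cavityField (cavityField f j) i σ)
          - cavityField (fun τ => Real.tanh (cavityField H j τ)) i σ * spinVar H i σ
            * (cavityField f i σ * cavityField f j σ)) := by
      funext σ
      rw [show genAt H f j = fun τ => centeredSpin H j τ * cavityField f j τ from rfl,
        cavityField_mul, cavityField_centeredSpin_of_ne H hij]
      ring
    rw [e1, gibbsSum_add, h, ← gibbsSum_add]
    congr 1
    funext σ
    rw [cavityField_mul, pairTerm, if_neg hij, cavityField_comm hij f σ]
    ring

theorem sum_pairTerm_ge {κ : ℝ} (hκ : κ ≤ 1 / 100) (H f : Config ι → ℝ) (σ : Config ι)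
    (hM : ‖Matrix.toEuclideanCLM (𝕜 := ℝ) (cavityMatrix H σ)‖ ≤ κ) :
    (1 / 2) * ∑ i, spinVar H i σ * cavityField f i σ ^ 2 ≤ ∑ i, ∑ j, pairTerm H f i j σ := by
  have hκ0 : 0 ≤ κ := (norm_nonneg _).trans hM
  set J : ι → ι → ℝ := fun i j => cavityField (cavityField H j) i σ with hJdef
  set d : ι → ℝ := fun i => spinVar H i σ * cavityField f i σ ^ 2 with hd
  set x : ι → ℝ := fun i => spinVar H i σ * cavityField f i σ with hx
  have hJM : ∀ i j, J i j ^ 2 = cavityMatrix H σ i j ^ 2 := fun i j => by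
    rw [cavityMatrix_apply, mul_pow, pow_two (spin _), spin_sq, one_mul]
  have hcol : ∀ j, ∑ i, J i j ^ 2 ≤ κ ^ 2 := fun j => by
    simp only [hJM]
    exact sum_sq_col_le_of_opNorm_le hM j
  have hsym : ∀ i j, J i j = J j i := fun i j => by
    by_cases h : i = j
    · rw [h]
    · exact cavityField_comm h H σ
  -- An entry is at most the norm of its column.
  have habs : ∀ i j, |J i j| ≤ 1 / 100 := fun i j => by
    refine (abs_le_of_sq_le_sq ?_ hκ0).trans hκ
    exact (Finset.single_le_sum (f := fun i => J i j ^ 2) (fun _ _ => sq_nonneg _)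
      (Finset.mem_univ i)).trans (hcol j)
  have hdnn : ∀ i, 0 ≤ d i := fun i => mul_nonneg (spinVar_pos H i σ).le (sq_nonneg _)
  have hxd : ∑ i, x i ^ 2 ≤ ∑ i, d i := Finset.sum_le_sum fun i _ => by
    have h1 := spinVar_le_one H i σ
    have h2 := hdnn i
    calc x i ^ 2 = spinVar H i σ * d i := by simp only [hx, hd]; ring
      _ ≤ 1 * d i := mul_le_mul_of_nonneg_right h1 h2
      _ = d i := one_mul _
  have hbil : ∑ i, ∑ j, J i j * (x i * x j) ≤ κ * ∑ i, x i ^ 2 := by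
    have h := sum_mul_le_of_opNorm_le hM (fun i => spin (σ i) * x i) x
      (Finset.sum_congr rfl fun i _ => by rw [mul_pow, pow_two (spin _), spin_sq, one_mul])
    refine le_of_eq_of_le ?_ h
    refine Finset.sum_congr rfl fun i _ => Finset.sum_congr rfl fun j _ => ?_
    rw [cavityMatrix_apply]
    linear_combination (-(J i j) * x i * x j) * spin_sq (σ i)
  have hq1 : ∑ i, ∑ j, J i j ^ 2 * d i ≤ κ ^ 2 * ∑ i, d i := by
    rw [Finset.mul_sum]
    refine Finset.sum_le_sum fun i _ => ?_
    rw [← Finset.sum_mul]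
    refine mul_le_mul_of_nonneg_right ?_ (hdnn i)
    simp only [hsym i]
    exact hcol i
  have hq2 : ∑ i, ∑ j, J i j ^ 2 * d j ≤ κ ^ 2 * ∑ i, d i := by
    rw [Finset.sum_comm]
    simpa only [hsym] using hq1
  have hlow : ∑ i, ∑ j, ((if i = j then d i else 0) - J i j * (x i * x j)
      - 50 * J i j ^ 2 * (d i + d j)) ≤ ∑ i, ∑ j, pairTerm H f i j σ :=
    Finset.sum_le_sum fun i _ => Finset.sum_le_sum fun j _ => pairTerm_ge H f i j σ (habs i j)
  have hexp : ∑ i, ∑ j, ((if i = j then d i else 0) - J i j * (x i * x j)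
      - 50 * J i j ^ 2 * (d i + d j)) = ∑ i, d i - ∑ i, ∑ j, J i j * (x i * x j)
      - 50 * (∑ i, ∑ j, J i j ^ 2 * d i + ∑ i, ∑ j, J i j ^ 2 * d j) := by
    simp only [Finset.sum_sub_distrib, Finset.sum_ite_eq, Finset.mem_univ, if_true, mul_add,
      Finset.sum_add_distrib, Finset.mul_sum, mul_assoc]
  have hS : 0 ≤ ∑ i, d i := Finset.sum_nonneg fun i _ => hdnn i
  have h1 : κ * ∑ i, x i ^ 2 ≤ 1 / 100 * ∑ i, d i :=
    mul_le_mul hκ hxd (Finset.sum_nonneg fun i _ => sq_nonneg _) (by norm_num)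
  have h2 : κ ^ 2 * ∑ i, d i ≤ 1 / 10000 * ∑ i, d i :=
    mul_le_mul_of_nonneg_right (by nlinarith) hS
  -- The constant obtained is 1 - 1/100 - 50 · 2/10000 = 98/100, more than the required 1/2.
  linarith

/-- The generator of the heat-bath dynamics (up to sign). -/
noncomputable def generator (H f : Config ι → ℝ) (σ : Config ι) : ℝ := ∑ j, genAt H f j σ

/-- The unnormalized Dirichlet form. -/
noncomputable def energy (H f h : Config ι → ℝ) : ℝ :=
  gibbsSum H fun σ => ∑ j, spinVar H j σ * cavityField f j σ * cavityField h j σ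

theorem gibbsSum_generator_mul (H f h : Config ι → ℝ) :
    gibbsSum H (fun σ => generator H f σ * h σ) = energy H f h := by
  simp only [generator, energy, Finset.sum_mul]
  rw [gibbsSum_sum, gibbsSum_sum]
  exact Finset.sum_congr rfl fun j _ => gibbsSum_genAt_mul H f h j

theorem half_energy_le {κ : ℝ} (hκ : κ ≤ 1 / 100) (H f : Config ι → ℝ)
    (hM : ∀ σ, ‖Matrix.toEuclideanCLM (𝕜 := ℝ) (cavityMatrix H σ)‖ ≤ κ) :
    (1 / 2) * energy H f f ≤ gibbsSum H (fun σ => generator H f σ ^ 2) := by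
  have e : gibbsSum H (fun σ => generator H f σ ^ 2) =
      gibbsSum H (fun σ => ∑ i, ∑ j, pairTerm H f i j σ) := by
    simp only [generator, pow_two, Finset.sum_mul_sum]
    rw [gibbsSum_sum, gibbsSum_sum]
    refine Finset.sum_congr rfl fun i _ => ?_
    rw [gibbsSum_sum, gibbsSum_sum]
    exact Finset.sum_congr rfl fun j _ => gibbsSum_genAt_mul_genAt H f i j
  rw [e, energy, ← gibbsSum_const_mul]
  refine gibbsSum_mono fun σ => ?_
  have := sum_pairTerm_ge hκ H f σ (hM σ)
  simpa only [pow_two, mul_assoc] using this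

/-- Completes the square. The weight 1/4 is matched to `half_energy_le`, so that D(h)/4 costs only
half of ⟨(Lh)²⟩. -/
theorem energy_add_le (H f h : Config ι → ℝ) :
    energy H f h ≤ (1 / 4) * energy H f f + energy H h h := by
  unfold energy
  rw [← gibbsSum_const_mul, ← gibbsSum_add]
  refine gibbsSum_mono fun σ => ?_
  rw [Finset.mul_sum, ← Finset.sum_add_distrib]
  refine Finset.sum_le_sum fun j _ => ?_
  nlinarith [mul_nonneg (spinVar_pos H j σ).le
    (sq_nonneg (cavityField f j σ / 2 - cavityField h j σ))]

theorem energy_self_nonneg (H f : Config ι → ℝ) : 0 ≤ energy H f f :=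
  gibbsSum_nonneg fun σ => Finset.sum_nonneg fun j _ => by
    rw [mul_assoc]
    exact mul_nonneg (spinVar_pos H j σ).le (mul_self_nonneg _)

theorem eq_of_energy_eq_zero {H f : Config ι → ℝ} (h : energy H f f = 0) (σ τ : Config ι) :
    f σ = f τ := by
  refine eq_of_partialD_eq_zero (fun j σ => ?_) σ τ
  have hnn : ∀ σ j, 0 ≤ spinVar H j σ * cavityField f j σ * cavityField f j σ := fun σ j => by
    rw [mul_assoc]
    exact mul_nonneg (spinVar_pos H j σ).le (mul_self_nonneg _)
  have h1 := gibbsSum_eq_zero (fun σ => Finset.sum_nonneg fun j _ => hnn σ j) h σ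
  have h2 := (Finset.sum_eq_zero_iff_of_nonneg (fun j _ => hnn σ j)).1 h1 j (Finset.mem_univ j)
  rw [mul_assoc] at h2
  simpa using (mul_eq_zero.1 h2).resolve_left (spinVar_pos H j σ).ne'

theorem gibbsSum_generator (H f : Config ι → ℝ) : gibbsSum H (generator H f) = 0 := by
  have h := gibbsSum_generator_mul H f (fun _ => 1)
  simpa [energy, cavityField_const, gibbsSum] using h

/-- The generator shifted by the mean, which makes it invertible. -/
noncomputable def shiftedGenerator (H : Config ι → ℝ) :
    (Config ι → ℝ) →ₗ[ℝ] (Config ι → ℝ) where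
  toFun f σ := generator H f σ + gibbsSum H f
  map_add' f h := by
    funext σ
    have e : gibbsSum H (f + h) = gibbsSum H f + gibbsSum H h := gibbsSum_add H f h
    have e' : generator H (f + h) σ = generator H f σ + generator H h σ := by
      simp only [generator, genAt, ← Finset.sum_add_distrib]
      refine Finset.sum_congr rfl fun j _ => ?_
      simp only [cavityField, partialD, Pi.add_apply]
      ring
    simp only [Pi.add_apply, e, e']
    ring
  map_smul' c f := by
    funext σ
    have e : gibbsSum H (c • f) = c * gibbsSum H f := gibbsSum_const_mul H f c
    have e' : generator H (c • f) σ = c * generator H f σ := by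
      simp only [generator, genAt, Finset.mul_sum]
      refine Finset.sum_congr rfl fun j _ => ?_
      simp only [cavityField, partialD, Pi.smul_apply, smul_eq_mul]
      ring
    simp only [Pi.smul_apply, smul_eq_mul, RingHom.id_apply, e, e']
    ring

theorem gibbsSum_shiftedGenerator (H f : Config ι → ℝ) :
    gibbsSum H (shiftedGenerator H f) = gibbsSum H f * gibbsSum H fun _ => 1 := by
  have e : gibbsSum H (shiftedGenerator H f) =
      gibbsSum H (generator H f) + gibbsSum H (fun _ => gibbsSum H f * 1) := by
    rw [← gibbsSum_add]
    simp [shiftedGenerator]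
  rw [e, gibbsSum_generator, gibbsSum_const_mul, zero_add]

/-- Since Lf has mean zero, a kernel element has mean zero and Lf = 0; then its energy vanishes, so
it is constant, hence zero. In finite dimension this gives surjectivity. -/
theorem shiftedGenerator_injective (H : Config ι → ℝ) :
    Function.Injective (shiftedGenerator H) := by
  rw [injective_iff_map_eq_zero]
  intro f hf
  have h1 : gibbsSum H f = 0 := by
    have h := gibbsSum_shiftedGenerator H f
    rw [hf] at h
    have h0 : gibbsSum H (0 : Config ι → ℝ) = 0 := by simp [gibbsSum]
    rw [h0] at h
    exact (mul_eq_zero.1 h.symm).resolve_right (gibbsSum_one_pos H).ne'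
  have h2 : ∀ σ, generator H f σ = 0 := fun σ => by
    have : generator H f σ + gibbsSum H f = 0 := congrFun hf σ
    linarith
  have h3 : energy H f f = 0 := by
    rw [← gibbsSum_generator_mul]
    simp [h2, gibbsSum]
  have hc := eq_of_energy_eq_zero h3
  funext σ
  have h4 : f = fun _ => f σ * 1 := by funext τ; rw [mul_one]; exact hc τ σ
  rw [h4, gibbsSum_const_mul] at h1
  exact (mul_eq_zero.1 h1).resolve_right (gibbsSum_one_pos H).ne'

/-- The Poincaré inequality for mean-zero functions. -/
theorem gibbsSum_sq_le {κ : ℝ} (hκ : κ ≤ 1 / 100) (H f : Config ι → ℝ)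
    (hM : ∀ σ, ‖Matrix.toEuclideanCLM (𝕜 := ℝ) (cavityMatrix H σ)‖ ≤ κ)
    (hf : gibbsSum H f = 0) : gibbsSum H (fun σ => f σ ^ 2) ≤ 2 * energy H f f := by
  obtain ⟨h, hh⟩ := LinearMap.injective_iff_surjective.1 (shiftedGenerator_injective H) f
  have h0 : gibbsSum H h = 0 := by
    have := gibbsSum_shiftedGenerator H h
    rw [hh, hf] at this
    exact (mul_eq_zero.1 this.symm).resolve_right (gibbsSum_one_pos H).ne'
  have hgen : ∀ σ, generator H h σ = f σ := fun σ => by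
    have : generator H h σ + gibbsSum H h = f σ := congrFun hh σ
    linarith
  have h1 := half_energy_le hκ H h hM
  have h2 := gibbsSum_generator_mul H h f
  simp only [hgen] at h1 h2
  simp only [← pow_two] at h2
  have h3 := energy_add_le H h f
  -- With f = Lh: ⟨f²⟩ = D(h, f) ≤ D(h)/4 + D(f) ≤ ⟨f²⟩/2 + D(f).
  linarith

end Gap

/-! ### Two-sided bounds on the inverse gap -/

section InverseGap

variable {ι : Type*} [Fintype ι] [DecidableEq ι]

theorem gibbsMean_eq (H f : Config ι → ℝ) :
    gibbsMean H f = gibbsSum H f / gibbsSum H fun _ => 1 := by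
  simp [gibbsMean, gibbsSum]

theorem dirichletForm_eq (H f : Config ι → ℝ) :
    dirichletForm H f = energy H f f / gibbsSum H fun _ => 1 := by
  simp only [dirichletForm, gibbsMean_eq]
  rw [← Finset.sum_div, energy, gibbsSum_sum]
  congr 1
  refine Finset.sum_congr rfl fun j _ => ?_
  congr 1
  funext σ
  rw [← spin_mul_cavityField, spinVar]
  linear_combination
    ((Real.cosh (cavityField H j σ) ^ 2)⁻¹ * cavityField f j σ ^ 2) * spin_sq (σ j)

theorem gibbsSum_sub_mean (H f : Config ι → ℝ) :
    gibbsSum H (fun σ => f σ - gibbsMean H f) = 0 := by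
  have e : (fun σ => f σ - gibbsMean H f) = fun σ => f σ + (-gibbsMean H f) * 1 := by
    funext σ; ring
  rw [e, gibbsSum_add, gibbsSum_const_mul, gibbsMean_eq]
  have := (gibbsSum_one_pos H).ne'
  field_simp
  ring

theorem gibbsCov_self_eq (H f : Config ι → ℝ) :
    gibbsCov H f f =
      gibbsSum H (fun σ => (f σ - gibbsMean H f) ^ 2) / gibbsSum H fun _ => 1 := by
  have e : (fun σ => (f σ - gibbsMean H f) ^ 2) = fun σ =>
      f σ * f σ + ((-2 * gibbsMean H f) * f σ + gibbsMean H f ^ 2 * 1) := by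
    funext σ; ring
  have hZ := (gibbsSum_one_pos H).ne'
  have hm : gibbsSum H f = gibbsMean H f * gibbsSum H fun _ => 1 := by
    rw [gibbsMean_eq]; field_simp
  rw [e, gibbsSum_add, gibbsSum_add, gibbsSum_const_mul, gibbsSum_const_mul, gibbsCov,
    gibbsMean_eq H fun σ => f σ * f σ, hm]
  field_simp
  ring

theorem gibbsCov_le {κ : ℝ} (hκ : κ ≤ 1 / 100) (H f : Config ι → ℝ)
    (hM : ∀ σ, ‖Matrix.toEuclideanCLM (𝕜 := ℝ) (cavityMatrix H σ)‖ ≤ κ) :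
    gibbsCov H f f ≤ 2 * dirichletForm H f := by
  rw [gibbsCov_self_eq, dirichletForm_eq, ← mul_div_assoc]
  refine div_le_div_of_nonneg_right ?_ (gibbsSum_one_pos H).le
  have h := gibbsSum_sq_le hκ H _ hM (gibbsSum_sub_mean H f)
  simpa only [energy, cavityField_sub_const] using h

theorem ratio_le {κ : ℝ} (hκ : κ ≤ 1 / 100) (H f : Config ι → ℝ)
    (hM : ∀ σ, ‖Matrix.toEuclideanCLM (𝕜 := ℝ) (cavityMatrix H σ)‖ ≤ κ) :
    gibbsCov H f f / dirichletForm H f ≤ 2 := by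
  refine div_le_of_le_mul₀ ?_ zero_le_two (gibbsCov_le hκ H f hM)
  rw [dirichletForm_eq]
  exact div_nonneg (energy_self_nonneg H f) (gibbsSum_one_pos H).le

theorem inverseGap_le {κ : ℝ} (hκ : κ ≤ 1 / 100) (H : Config ι → ℝ)
    (hM : ∀ σ, ‖Matrix.toEuclideanCLM (𝕜 := ℝ) (cavityMatrix H σ)‖ ≤ κ) :
    inverseGap H ≤ 2 :=
  -- Nonnegativity of 2 covers an empty index type, where the supremum of the empty set is 0.
  Real.sSup_le (by rintro r ⟨f, -, rfl⟩; exact ratio_le hκ H f hM) zero_le_two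

/-- The spin at a site has conditional variance at most its variance. -/
theorem dirichletForm_spin_le (H : Config ι → ℝ) (j : ι) :
    dirichletForm H (fun σ => spin (σ j)) ≤
      gibbsCov H (fun σ => spin (σ j)) (fun σ => spin (σ j)) := by
  rw [gibbsCov_self_eq, dirichletForm_eq]
  refine div_le_div_of_nonneg_right ?_ (gibbsSum_one_pos H).le
  set m := gibbsMean H (fun σ => spin (σ j))
  have hen : energy H (fun σ => spin (σ j)) (fun σ => spin (σ j)) = gibbsSum H (spinVar H j) := by
    unfold energy
    congr 1
    funext σ
    simp [cavityField_spin]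
  have h1 := gibbsSum_centeredSpin_mul H j (φ := fun _ => 1) (fun _ => rfl) (centeredSpin H j)
  have h2 := gibbsSum_centeredSpin_mul H j
    (φ := fun σ => Real.tanh (cavityField H j σ) - m)
    (fun σ => by simp only [cavityField_flipAt_self]) (fun _ => 1)
  simp only [cavityField_centeredSpin_self, cavityField_const, mul_one, mul_zero] at h1 h2
  have h3 : gibbsSum H (fun _ => (0 : ℝ)) = 0 := by simp [gibbsSum]
  -- The law of total variance; the cross term vanishes by integrating by parts against a constant.
  have e : (fun σ : Config ι => (spin (σ j) - m) ^ 2) = fun σ =>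
      centeredSpin H j σ * centeredSpin H j σ +
      (2 * (centeredSpin H j σ * (Real.tanh (cavityField H j σ) - m)) +
        (Real.tanh (cavityField H j σ) - m) ^ 2) := by
    funext σ
    rw [centeredSpin]
    ring
  rw [hen, e, gibbsSum_add, gibbsSum_add, gibbsSum_const_mul, h1, h2, h3]
  have := gibbsSum_nonneg (H := H) (fun σ => sq_nonneg (Real.tanh (cavityField H j σ) - m))
  change gibbsSum H (fun σ => spinVar H j σ) ≤ _
  linarith

theorem one_le_inverseGap [Nonempty ι] {κ : ℝ} (hκ : κ ≤ 1 / 100) (H : Config ι → ℝ)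
    (hM : ∀ σ, ‖Matrix.toEuclideanCLM (𝕜 := ℝ) (cavityMatrix H σ)‖ ≤ κ) :
    1 ≤ inverseGap H := by
  obtain ⟨j⟩ := ‹Nonempty ι›
  have hnc : ¬ ∃ c : ℝ, ∀ σ : Config ι, spin (σ j) = c := by
    rintro ⟨c, hc⟩
    have h1 := hc fun _ => 1
    have h2 := hc fun _ => -1
    simp only [spin_neg] at h2
    norm_num [spin] at h1 h2
    linarith
  have hpos : 0 < dirichletForm H (fun σ => spin (σ j)) := by
    rw [dirichletForm_eq]
    refine div_pos (lt_of_le_of_ne (energy_self_nonneg _ _) fun h => hnc ?_) (gibbsSum_one_pos H)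
    exact ⟨spin 1, fun σ => eq_of_energy_eq_zero h.symm σ fun _ => 1⟩
  refine le_trans ?_ (le_csSup ⟨2, ?_⟩ ⟨_, hnc, rfl⟩)
  · rw [one_le_div hpos]
    exact dirichletForm_spin_le H j
  · rintro r ⟨f, -, rfl⟩
    exact ratio_le hκ H f hM

end InverseGap

/-! ### Maxima over subsystems and conclusion -/

theorem maxInverseGap_le {N : ℕ} {βs : ℕ → ℝ} {η : Fin N → ℝ}
    {g : (p : ℕ) → (Fin p → Fin N) → ℝ} {κ : ℝ} (hκ : κ ≤ 1 / 100)
    (hM : ∀ A B : Finset (Fin N), Disjoint A B → ∀ (σA : Config A) (τ : Config (Free A B)),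
      ‖Matrix.toEuclideanCLM (𝕜 := ℝ) (cavityMatrix (subHamiltonian βs η g A B σA) τ)‖ ≤ κ)
    (k : ℕ) : maxInverseGap βs η g k ≤ 2 := by
  refine Real.sSup_le ?_ zero_le_two
  rintro a ⟨A, B, hAB, -, σA, rfl⟩
  exact inverseGap_le hκ _ (hM A B hAB σA)

theorem one_le_maxInverseGap {N : ℕ} {βs : ℕ → ℝ} {η : Fin N → ℝ}
    {g : (p : ℕ) → (Fin p → Fin N) → ℝ} {κ : ℝ} (hκ : κ ≤ 1 / 100)
    (hM : ∀ A B : Finset (Fin N), Disjoint A B → ∀ (σA : Config A) (τ : Config (Free A B)),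
      ‖Matrix.toEuclideanCLM (𝕜 := ℝ) (cavityMatrix (subHamiltonian βs η g A B σA) τ)‖ ≤ κ)
    {k : ℕ} (hk : k < N) : 1 ≤ maxInverseGap βs η g k := by
  obtain ⟨B, -, hB⟩ := Finset.exists_subset_card_eq (s := (Finset.univ : Finset (Fin N))) (n := k)
    (by simpa using hk.le)
  have hd : Disjoint ∅ B := Finset.disjoint_empty_left B
  have hne : Nonempty (Free ∅ B) := by
    obtain ⟨i, hi⟩ := Finset.exists_mem_notMem_of_card_lt_card
      (s := B) (t := (Finset.univ : Finset (Fin N))) (by simpa [hB] using hk)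
    exact ⟨⟨i, by simpa using hi⟩⟩
  refine (one_le_inverseGap hκ _ (hM ∅ B hd fun _ => 1)).trans
    (le_csSup ⟨2, ?_⟩ ⟨∅, B, hd, by simpa using hB, _, rfl⟩)
  rintro a ⟨A, B, hAB, -, σA, rfl⟩
  exact inverseGap_le hκ _ (hM A B hAB σA)

end MixedPSpin

theorem mainTheorem2 :
    ∃ β₀ : ℝ, 0 < β₀ ∧ ∃ C : ℝ, 0 < C ∧
      ∀ {Ω : Type*} [MeasurableSpace Ω] (μ : Measure Ω) [IsProbabilityMeasure μ]
        (N : ℕ) (_ : 1 ≤ N)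
        (βs : ℕ → ℝ) (_ : ∀ p, 2 ≤ p → 0 ≤ βs p)
        (_ : Summable fun p : {p : ℕ // 2 ≤ p} =>
          Real.sqrt ((p.1 : ℝ) ^ 3 * Real.log p.1) * βs p.1)
        (_ : 0 < temperature βs) (_ : temperature βs ≤ β₀)
        (η : Fin N → ℝ) (g : (p : ℕ) → (Fin p → Fin N) → Ω → ℝ)
        (_ : IsGaussianCouplings μ g)
        (ε : ℝ) (_ : 0 < ε) (_ : ε < 1 / 10 ^ 2),
        μ.real (goodEvent βs η g ∩ ⋃ k ∈ {k : ℕ | k + 2 ≤ N},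
          {ω | maxInverseGap βs η (fun p i => g p i ω) (k + 1) * Cconst (temperature βs) < ε ∧
            5 * maxInverseGap βs η (fun p i => g p i ω) (k + 1) <
              maxInverseGap βs η (fun p i => g p i ω) k})
          ≤ C * Real.exp ((C * ε / Cconst (temperature βs) + 2) * Real.log N + N * Real.log 4
              - N * Cconst (temperature βs) ^ 2 / (C * ε ^ 2 * temperature βs ^ 2)) := by
  -- 1/500 makes 5β at most 1/100. The event is empty, so any positive C serves.
  refine ⟨1 / 500, by norm_num, 1, one_pos, ?_⟩
  intro Ω _ μ _ N _ βs _ _ _ hβ η g _ ε _ _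
  refine le_trans (le_of_eq ?_) (mul_nonneg zero_le_one (Real.exp_pos _).le)
  rw [measureReal_eq_zero_iff]
  convert measure_empty (μ := μ)
  rw [Set.eq_empty_iff_forall_notMem]
  rintro ω ⟨hgood, hω⟩
  simp only [Set.mem_iUnion, Set.mem_ofPred_eq] at hω
  obtain ⟨k, hk, -, hjump⟩ := hω
  have hκ : 5 * temperature βs ≤ 1 / 100 := by linarith
  -- The range k + 2 ≤ N leaves at least one free spin in the smaller subsystems, as the lower bound
  -- requires.
  have h1 := one_le_maxInverseGap hκ hgood (show k + 1 < N by omega)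
  have h2 := maxInverseGap_le hκ hgood k
  linarith
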